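/- Let $n\ge 2$, let $G=\mathfrak S_{n+1}$ and let $\lambda=(2,1^{n-1})$, a partition of $n+1$. *The Specht lattice.* For a tableau $t$ of shape $\lambda$ (a bijective filling with $1,\dots,n+1$) let $\{t\}$ be its tabloid (its class under row equivalence), let $C_t\le G$ be its column stabilizer, and let $e_t=\sum_{\pi\in C_t}\operatorname{sgn}(\pi)\{\pi t\}$ be its polytabloid, an element of the $\mathbf Q G$-permutation module $M^\lambda$ on the tabloids of shape $\lambda$. The Specht lattice is $L^\lambda=\bigoplus_T\mathbf Z e_T\subseteq M^\lambda$, where $T$ runs through the standard tableaux of shape $\lambda$. *Craig's lattices.* Let $V=\mathbf Q^n$, with standard basis $e_1,\dots,e_n$, be the (unique) $\mathbf QG$-module on which, for $1\le k\le n$, the transposition $(k\ \,k+1)$ acts on column vectors by multiplication with the matrix $E^{k,k-1}+2E^{k,k}+E^{k,k+1}-I_n$, where $E^{i,j}$ is the $n\times n$ matrix unit and $E^{i,j}=0$ if $i$ or $j$ is not in $\{1,\dots,n\}$. Put $v=e_n+\sum_{i=1}^{n-1}(-1)^{n+1-i}\,i\,e_i$ and, for a divisor $d$ of $n+1$, let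 $L(d)=\bigl(\bigoplus_{i=1}^{n-1}\mathbf Z\,d\,e_i\bigr)\oplus\mathbf Z v\subseteq V$, which is a $\mathbf ZG$-lattice. Then the polytabloids $e_T$, $T$ standard, are linearly independent, $L^\lambda$ is stable under $G$, and $$L^\lambda\cong L(n+1)\quad\text{as }\mathbf ZG\text{-modules.}$$ Moreover, for every prime $p$ dividing $n+1$: 1. $L^\lambda$ has exactly one $p$-maximal sublattice, that is, exactly one maximal $\mathbf ZG$-sublattice $N$ with $pL^\lambda\subseteq N$, and this sublattice has index $p$ in $L^\lambda$; 2. $\mathbf Z_p\otimes_{\mathbf Z}L^\lambda\cong\mathbf Z_p\otimes_{\mathbf Z}L(p^{v_p(n+1)})$ as $\mathbf Z_pG$-modules, where $v_p$ is the $p$-adic valuation. -/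

import Mathlib

open scoped TensorProduct

noncomputable section

namespace SpechtCraig

/-! ### Lattices and representations -/

/-- A `ℚG`-module regarded as a `ℤG`-module. -/
def restrictInt {G V : Type*} [Group G] [AddCommGroup V] [Module ℚ V]
    (ρ : Representation ℚ G V) : Representation ℤ G V where
  toFun g := (ρ g).restrictScalars ℤ
  map_one' := by ext; simp
  map_mul' g h := by ext; simp

@[simp] theorem restrictInt_apply {G V : Type*} [Group G] [AddCommGroup V] [Module ℚ V]
    (ρ : Representation ℚ G V) (g : G) (x : V) : restrictInt ρ g x = ρ g x := rfl

/-- The `p`-adic completion `M_p = ℤ_p ⊗ M` of a `ℤG`-module `M`, as a `ℤ_p G`-module. -/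
def completion (p : ℕ) [Fact p.Prime] {G M : Type*} [Group G] [AddCommGroup M]
    (ρ : Representation ℤ G M) : Representation ℤ_[p] G (ℤ_[p] ⊗[ℤ] M) where
  toFun g := (ρ g).baseChange ℤ_[p]
  map_one' := by ext; simp
  map_mul' g h := by ext; simp

/-- `N` is a `p`-maximal sublattice of the `ℤG`-lattice `M`: it is a maximal `ℤG`-sublattice
and `pM ⊆ N`. -/
def IsPMaximal (p : ℕ) {G M : Type*} [Group G] [AddCommGroup M]
    {ρ : Representation ℤ G M} (N : Subrepresentation ρ) : Prop :=
  IsCoatom N ∧ ∀ x : M, (p : ℤ) • x ∈ N.toSubmodule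

/-! ### Tableaux, tabloids, polytabloids and the Specht lattice -/

/-- Tableaux of shape `μ` with entries `0, …, N - 1`, each occurring exactly once.
(This type is empty unless `μ` has `N` cells.) -/
def Tableau (μ : YoungDiagram) (N : ℕ) : Type := {c : ℕ × ℕ // c ∈ μ} ≃ Fin N

namespace Tableau

variable {μ : YoungDiagram} {N : ℕ}

/-- The entry of `t` in the cell `c`. -/
def entry (t : Tableau μ N) (c : {c : ℕ × ℕ // c ∈ μ}) : Fin N := Equiv.toFun t c

/-- The row of `t` containing the entry `a`. -/
def row (t : Tableau μ N) (a : Fin N) : ℕ := (Equiv.symm t a).1.1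

/-- The column of `t` containing the entry `a`. -/
def col (t : Tableau μ N) (a : Fin N) : ℕ := (Equiv.symm t a).1.2

/-- `Equiv.Perm (Fin N)` acts on tableaux by permuting the entries. -/
instance : MulAction (Equiv.Perm (Fin N)) (Tableau μ N) where
  smul g t := Equiv.trans t g
  one_smul _ := rfl
  mul_smul _ _ _ := rfl

theorem entry_smul (g : Equiv.Perm (Fin N)) (t : Tableau μ N) (c : {c : ℕ × ℕ // c ∈ μ}) :
    (g • t).entry c = g (t.entry c) := rfl

theorem row_smul (g : Equiv.Perm (Fin N)) (t : Tableau μ N) (a : Fin N) :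
    (g • t).row a = t.row (g⁻¹ a) := rfl

/-- Standard tableaux: entries increase along the rows and down the columns. -/
def IsStandard (t : Tableau μ N) : Prop :=
  (∀ c c' : {c : ℕ × ℕ // c ∈ μ}, c.1.1 = c'.1.1 → c.1.2 < c'.1.2 → t.entry c < t.entry c') ∧
  (∀ c c' : {c : ℕ × ℕ // c ∈ μ}, c.1.2 = c'.1.2 → c.1.1 < c'.1.1 → t.entry c < t.entry c')

/-- Two tableaux are row equivalent if corresponding rows have the same sets of entries. -/
def rowSetoid (μ : YoungDiagram) (N : ℕ) : Setoid (Tableau μ N) where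
  r t t' := ∀ a, t.row a = t'.row a
  iseqv := ⟨fun _ _ => rfl, fun h a => (h a).symm, fun h h' a => (h a).trans (h' a)⟩

/-- The column stabilizer `C_t` of a tableau `t`. -/
def colStabilizer (t : Tableau μ N) : Set (Equiv.Perm (Fin N)) :=
  {π | ∀ a, t.col (π a) = t.col a}

end Tableau

/-- Tabloids of shape `μ`: row equivalence classes of tableaux. -/
def Tabloid (μ : YoungDiagram) (N : ℕ) : Type := Quotient (Tableau.rowSetoid μ N)

/-- The tabloid `{t}` of a tableau `t`. -/
def Tabloid.mk {μ : YoungDiagram} {N : ℕ} (t : Tableau μ N) : Tabloid μ N :=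
  Quotient.mk (Tableau.rowSetoid μ N) t

/-- The action on tabloids, `g • {t} = {g • t}`. -/
instance (μ : YoungDiagram) (N : ℕ) : MulAction (Equiv.Perm (Fin N)) (Tabloid μ N) where
  smul g := Quotient.map (fun t => g • t) (fun _ _ h a => h (g⁻¹ a))
  one_smul := by rintro ⟨t⟩; rfl
  mul_smul := by rintro g h ⟨t⟩; rfl

theorem Tabloid.smul_mk {μ : YoungDiagram} {N : ℕ} (g : Equiv.Perm (Fin N)) (t : Tableau μ N) :
    g • Tabloid.mk t = Tabloid.mk (g • t) := rfl

/-- The permutation module `M^μ` over `ℚ`, with basis the tabloids of shape `μ`. -/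
def permModule (μ : YoungDiagram) (N : ℕ) :
    Representation ℚ (Equiv.Perm (Fin N)) (Tabloid μ N →₀ ℚ) where
  toFun g := Finsupp.lmapDomain ℚ ℚ (fun x => g • x)
  map_one' := by ext; simp
  map_mul' g h := by ext; simp [mul_smul]

open scoped Classical in
/-- The polytabloid `e_t = ∑_{π ∈ C_t} sgn(π) {π t}`. -/
def polytabloid {μ : YoungDiagram} {N : ℕ} (t : Tableau μ N) : Tabloid μ N →₀ ℚ :=
  ∑ π : Equiv.Perm (Fin N) with π ∈ t.colStabilizer,
    Finsupp.single (Tabloid.mk (π • t)) (((Equiv.Perm.sign π : ℤˣ) : ℤ) : ℚ)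

/-- The `ℤ`-span of the polytabloids `e_T`, with `T` running through the standard tableaux of
shape `μ`. -/
def spechtLattice (μ : YoungDiagram) (N : ℕ) : Submodule ℤ (Tabloid μ N →₀ ℚ) :=
  Submodule.span ℤ {x | ∃ T : Tableau μ N, T.IsStandard ∧ polytabloid T = x}

/-- The hook partition `(2, 1^{n-1})` (of `n + 1`, for `n ≥ 1`). -/
def hook (n : ℕ) : YoungDiagram :=
  YoungDiagram.ofRowLens (2 :: List.replicate (n - 1) 1) (by
    rw [List.sortedGE_iff_pairwise, List.pairwise_cons]
    refine ⟨fun b hb => ?_, List.pairwise_replicate.mpr (Or.inr le_rfl)⟩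
    rw [List.eq_of_mem_replicate hb]
    decide)

/-! ### Craig's representation and Craig's lattices

Indices are shifted by one: the basis vector `e_i` is `Pi.single (i - 1) 1`. -/

/-- The matrix unit `E^{i,j}`, with rows and columns numbered from `0`; it is `0` if `i` or `j`
is out of range. -/
def matE (n : ℕ) (i j : ℤ) : Matrix (Fin n) (Fin n) ℚ :=
  Matrix.of fun a b => if (a : ℤ) = i ∧ (b : ℤ) = j then 1 else 0

/-- The matrix `E^{k,k-1} + 2 E^{k,k} + E^{k,k+1} - I`. -/
def craigMatrix (n : ℕ) (k : Fin n) : Matrix (Fin n) (Fin n) ℚ :=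
  matE n k (k - 1) + (2 : ℚ) • matE n k k + matE n k (k + 1) - 1

/-- The representation of the symmetric group on `ℚ^(n+1)` by permutations twisted by signs. -/
def signPerm (n : ℕ) : Representation ℚ (Equiv.Perm (Fin (n + 1))) (Fin (n + 1) → ℚ) where
  toFun g := (((Equiv.Perm.sign g : ℤˣ) : ℤ) : ℚ) • LinearMap.funLeft ℚ ℚ (g⁻¹ : Equiv.Perm _)
  map_one' := by ext; simp
  map_mul' g h := by
    ext x a
    simp [LinearMap.funLeft_apply]
    ring

/-- The embedding of `ℚ^n` in `ℚ^(n+1)` with `e_i ↦ ± (ε_i - ε_{i+1})`. -/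
def emb (n : ℕ) : (Fin n → ℚ) →ₗ[ℚ] (Fin (n + 1) → ℚ) :=
  Fintype.linearCombination ℚ (fun j : Fin n =>
    (-1 : ℚ) ^ (j : ℕ) • (Pi.single j.castSucc (1 : ℚ) - Pi.single j.succ (1 : ℚ)))

theorem emb_single (n : ℕ) (j : Fin n) :
    emb n (Pi.single j 1) =
      (-1 : ℚ) ^ (j : ℕ) • (Pi.single j.castSucc (1 : ℚ) - Pi.single j.succ (1 : ℚ)) := by
  simp [emb, Fintype.linearCombination_apply_single]

theorem emb_injective (n : ℕ) : Function.Injective (emb n) := by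
  let ψ : (Fin (n + 1) → ℚ) →ₗ[ℚ] (Fin n → ℚ) :=
    LinearMap.pi fun i => (-1 : ℚ) ^ (i : ℕ) • ∑ a : Fin (n + 1) with a ≤ i.castSucc,
      LinearMap.proj a
  have h : ψ ∘ₗ emb n = LinearMap.id := by
    ext j i
    have h1 : (Finset.univ.filter fun a : Fin (n + 1) => a ≤ i.castSucc) =
      Finset.Iic i.castSucc := by ext; simp
    simp only [ψ, LinearMap.comp_apply, LinearMap.single_apply, emb_single, LinearMap.id_apply,
      LinearMap.pi_apply, LinearMap.smul_apply, LinearMap.sum_apply, LinearMap.proj_apply,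
      Pi.smul_apply, Pi.sub_apply, smul_eq_mul, ← Finset.mul_sum, Finset.sum_sub_distrib, h1,
      Pi.single_apply, Finset.sum_ite_eq', Finset.mem_Iic]
    simp only [Fin.le_def, Fin.val_succ, Fin.val_castSucc, Fin.ext_iff]
    rcases lt_trichotomy (i : ℕ) (j : ℕ) with hij | hij | hij
    · rw [if_neg (by omega), if_neg (by omega), if_neg (by omega)]; simp
    · rw [if_pos (by omega), if_neg (by omega), if_pos (by omega), hij, sub_zero, mul_one,
        ← pow_add, ← two_mul, pow_mul]; simp
    · rw [if_pos (by omega), if_pos (by omega), if_neg (by omega)]; simp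
  exact Function.LeftInverse.injective (g := ψ) (fun x => LinearMap.congr_fun h x)

/-- The `(k, j)` entry of `E^{k,k-1} + 2 E^{k,k} + E^{k,k+1}`. -/
def craigCoef {n : ℕ} (k j : Fin n) : ℤ :=
  if j = k then 2 else if (j : ℕ) + 1 = k ∨ (k : ℕ) + 1 = j then 1 else 0

theorem craigMatrix_single {n : ℕ} (k j : Fin n) :
    Matrix.toLin' (craigMatrix n k) (Pi.single j 1) =
      -Pi.single j 1 + (craigCoef k j : ℚ) • Pi.single k 1 := by
  ext a
  simp only [Matrix.toLin'_apply, Matrix.mulVec_single_one, Matrix.col_apply, craigMatrix, matE,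
    craigCoef, Matrix.sub_apply, Matrix.add_apply, Matrix.smul_apply, Matrix.of_apply,
    Matrix.one_apply, Pi.add_apply, Pi.neg_apply, Pi.smul_apply, Pi.single_apply, smul_eq_mul,
    Fin.ext_iff]
  split_ifs <;> first | omega | norm_num

theorem signPerm_emb (n : ℕ) (k : Fin n) (x : Fin n → ℚ) :
    signPerm n (Equiv.swap k.castSucc k.succ) (emb n x) =
      emb n (Matrix.toLin' (craigMatrix n k) x) := by
  suffices h : signPerm n (Equiv.swap k.castSucc k.succ) ∘ₗ emb n =
      emb n ∘ₗ Matrix.toLin' (craigMatrix n k) from LinearMap.congr_fun h x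
  have hs : Equiv.Perm.sign (Equiv.swap k.castSucc k.succ) = -1 :=
    Equiv.Perm.sign_swap (Fin.castSucc_lt_succ (i := k)).ne
  ext j a
  simp only [LinearMap.comp_apply, LinearMap.single_apply, craigMatrix_single, map_add, map_neg,
    map_smul, emb_single, signPerm, MonoidHom.coe_mk, OneHom.coe_mk, LinearMap.smul_apply, hs,
    Pi.smul_apply, Pi.add_apply, Pi.neg_apply, Pi.sub_apply, LinearMap.funLeft_apply,
    Equiv.swap_inv, smul_eq_mul, Pi.single_apply, Equiv.swap_apply_def, craigCoef]
  simp only [apply_ite Fin.val, Fin.ext_iff, Fin.val_succ, Fin.val_castSucc]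
  by_cases h1 : (j : ℕ) = k
  · rw [h1]
    split_ifs <;> first | (exfalso; omega) | (norm_num; try ring)
  by_cases h2 : (j : ℕ) + 1 = k
  · rw [← h2, pow_succ]
    split_ifs <;> first | (exfalso; omega) | norm_num
  by_cases h3 : (k : ℕ) + 1 = j
  · rw [← h3, pow_succ]
    split_ifs <;> first | (exfalso; omega) | norm_num
  split_ifs <;> first | (exfalso; omega) | norm_num

/-- There is exactly one representation of the symmetric group on `ℚ^n` in which each adjacent
transposition acts by multiplication with the matrix `craigMatrix n k`. -/
theorem existsUnique_craigRep (n : ℕ) :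
    ∃! ρ : Representation ℚ (Equiv.Perm (Fin (n + 1))) (Fin n → ℚ),
      ∀ k : Fin n, ρ (Equiv.swap k.castSucc k.succ) = Matrix.toLin' (craigMatrix n k) := by
  have hst : ∀ g : Equiv.Perm (Fin (n + 1)), ∀ x, ∃ y, emb n y = signPerm n g (emb n x) := by
    intro g
    have hg : g ∈ Submonoid.closure
        (Set.range fun i : Fin n => Equiv.swap i.castSucc i.succ) := by
      rw [Equiv.Perm.mclosure_swap_castSucc_succ]; trivial
    induction hg using Submonoid.closure_induction with
    | mem g hg => obtain ⟨k, rfl⟩ := hg; exact fun x => ⟨_, (signPerm_emb n k x).symm⟩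
    | one => exact fun x => ⟨x, by simp⟩
    | mul g h _ _ ihg ihh =>
      intro x
      obtain ⟨y, hy⟩ := ihh x
      obtain ⟨z, hz⟩ := ihg y
      exact ⟨z, by rw [hz, hy, map_mul]; rfl⟩
  choose f hf using hst
  refine existsUnique_of_exists_of_unique
    ⟨⟨⟨fun g => ⟨⟨f g, fun x y => ?_⟩, fun c x => ?_⟩, ?_⟩, fun g h => ?_⟩, fun k => ?_⟩ ?_
  · exact emb_injective n (by simp [hf])
  · exact emb_injective n (by simp [hf])
  · exact LinearMap.ext fun x => emb_injective n (by simpa using hf 1 x)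
  · refine LinearMap.ext fun x => emb_injective n ?_
    change emb n (f (g * h) x) = emb n (f g (f h x))
    rw [hf, hf, hf, map_mul]; rfl
  · refine LinearMap.ext fun x => emb_injective n ?_
    change emb n (f _ x) = _
    rw [hf, signPerm_emb]
  · intro ρ ρ' hρ hρ'
    refine MonoidHom.ext fun g => ?_
    have hg : g ∈ Submonoid.closure
        (Set.range fun i : Fin n => Equiv.swap i.castSucc i.succ) := by
      rw [Equiv.Perm.mclosure_swap_castSucc_succ]; trivial
    induction hg using Submonoid.closure_induction with
    | mem g hg => obtain ⟨k, rfl⟩ := hg; rw [hρ, hρ']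
    | one => rw [map_one, map_one]
    | mul g h _ _ ihg ihh => rw [map_mul, map_mul, ihg, ihh]

/-- The representation `V` of the symmetric group on `ℚ^n` in which the adjacent transpositions
act by multiplication with the matrices `E^{k,k-1} + 2 E^{k,k} + E^{k,k+1} - I`. -/
def craigRep (n : ℕ) : Representation ℚ (Equiv.Perm (Fin (n + 1))) (Fin n → ℚ) :=
  (existsUnique_craigRep n).choose

theorem craigRep_swap (n : ℕ) (k : Fin n) :
    craigRep n (Equiv.swap k.castSucc k.succ) = Matrix.toLin' (craigMatrix n k) :=
  (existsUnique_craigRep n).choose_spec.1 k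

/-- The vector `v = e_n + ∑_{i < n} (-1)^(n+1-i) i e_i` (with `i` shifted by one). -/
def craigVec (n : ℕ) : Fin n → ℚ := fun i =>
  if (i : ℕ) + 1 = n then 1 else (-1) ^ (n - (i : ℕ)) * ((i : ℕ) + 1)

/-- The `ℤ`-module `(⨁_{i < n} ℤ d e_i) ⊕ ℤ v`. -/
def craigSpan (n d : ℕ) : Submodule ℤ (Fin n → ℚ) :=
  Submodule.span ℤ
    ({x | ∃ i : Fin n, (i : ℕ) + 1 < n ∧ Pi.single i (d : ℚ) = x} ∪ {craigVec n})

theorem craigMatrix_apply {n : ℕ} (k : Fin n) (x : Fin n → ℚ) :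
    Matrix.toLin' (craigMatrix n k) x =
      -x + (∑ j, (craigCoef k j : ℚ) * x j) • Pi.single k 1 := by
  have h : Matrix.toLin' (craigMatrix n k) = -LinearMap.id +
      (∑ j, (craigCoef k j : ℚ) • LinearMap.proj (R := ℚ) (φ := fun _ : Fin n => ℚ) j).smulRight
        (Pi.single k 1) := by
    ext j a
    simp only [LinearMap.comp_apply, LinearMap.single_apply, craigMatrix_single]
    simp [Pi.single_apply]
  rw [h]
  simp

theorem single_mem_craigSpan {n d : ℕ} (i : Fin n) : Pi.single i (d : ℚ) ∈ craigSpan n d := by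
  have hlt : ∀ i : Fin n, (i : ℕ) + 1 < n → Pi.single i (d : ℚ) ∈ craigSpan n d := fun i hi =>
    Submodule.subset_span (Or.inl ⟨i, hi, rfl⟩)
  by_cases hi : (i : ℕ) + 1 < n
  · exact hlt i hi
  have hi' : (i : ℕ) + 1 = n := by omega
  have hv : craigVec n ∈ craigSpan n d := Submodule.subset_span (Or.inr rfl)
  have key : Pi.single i (d : ℚ) = (d : ℤ) • craigVec n -
      ∑ j ∈ Finset.univ.erase i, ((-1 : ℤ) ^ (n - (j : ℕ)) * ((j : ℕ) + 1)) •
        Pi.single j (d : ℚ) := by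
    ext a
    by_cases ha : a = i
    · subst ha
      simp [craigVec, hi', Finset.sum_apply, Pi.single_apply]
    · have ha' : (a : ℕ) + 1 ≠ n := fun h => ha (Fin.ext (by omega))
      simp [craigVec, ha', Finset.sum_apply, Pi.single_apply, ha]
      ring
  rw [key]
  refine sub_mem (Submodule.smul_mem _ _ hv) (Submodule.sum_mem _ fun j hj => ?_)
  refine Submodule.smul_mem _ _ (hlt j ?_)
  have : (j : ℕ) ≠ i := fun h => (Finset.ne_of_mem_erase hj) (Fin.ext h)
  omega

theorem sum_craigCoef_craigVec {n : ℕ} (k : Fin n) :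
    ∃ m : ℤ, ∑ j, (craigCoef k j : ℚ) * craigVec n j = m * (n + 1) := by
  -- the coordinates of `v`, extended to all natural numbers
  let w : ℕ → ℚ := fun i => if i + 1 = n then 1 else (-1) ^ (n - i) * ((i : ℚ) + 1)
  let c : ℕ → ℚ := fun i => (if i = k then 2 else 0) + (if i + 1 = k then 1 else 0) +
    (if (k : ℕ) + 1 = i then 1 else 0)
  have h1 : ∑ j, (craigCoef k j : ℚ) * craigVec n j = ∑ i ∈ Finset.range n, c i * w i := by
    rw [← Fin.sum_univ_eq_sum_range]
    refine Finset.sum_congr rfl fun j _ => ?_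
    congr 1
    simp only [craigCoef, c, Fin.ext_iff]
    split_ifs <;> first | (exfalso; omega) | norm_num
  have hk := k.isLt
  have h2 : ∑ i ∈ Finset.range n, c i * w i = 2 * w k + (if 0 < (k : ℕ) then w (k - 1) else 0) +
      (if (k : ℕ) + 1 < n then w (k + 1) else 0) := by
    simp only [c, add_mul, ite_mul, zero_mul, one_mul, Finset.sum_add_distrib]
    congr 1
    · congr 1
      · rw [Finset.sum_ite_eq' (Finset.range n) (k : ℕ) (fun i => 2 * w i)]
        simp
      · split_ifs with h0
        · rw [Finset.sum_eq_single ((k : ℕ) - 1)]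
          · rw [if_pos (by omega)]
          · intro b _ hb; rw [if_neg (by omega)]
          · intro hb; exact absurd (Finset.mem_range.2 (by omega)) hb
        · exact Finset.sum_eq_zero fun i _ => if_neg (by omega)
    · rw [Finset.sum_ite_eq (Finset.range n) ((k : ℕ) + 1) (fun i => w i)]
      simp
  rw [h1, h2]
  clear h1 h2
  dsimp only [w]
  clear_value c
  clear c
  generalize hm : (k : ℕ) = m at hk ⊢
  clear hm k
  obtain ⟨r, rfl⟩ : ∃ r, n = m + 1 + r := ⟨n - (m + 1), by omega⟩
  rcases m with _ | k <;> rcases r with _ | _ | r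
  · exact ⟨1, by norm_num⟩
  · exact ⟨1, by norm_num⟩
  · refine ⟨0, ?_⟩
    have e1 : 0 + 1 + (r + 1 + 1) - 0 = r + 3 := by omega
    have e2 : 0 + 1 + (r + 1 + 1) - (0 + 1) = r + 2 := by omega
    simp only [e1, e2]
    split_ifs <;> first | (exfalso; omega) | (push_cast; ring)
  · refine ⟨1, ?_⟩
    have e1 : k + 1 + 1 + 0 - (k + 1 - 1) = 2 := by omega
    simp only [e1]
    split_ifs <;> first | (exfalso; omega) | (push_cast; ring)
  · refine ⟨1, ?_⟩
    have e1 : k + 1 + 1 + (0 + 1) - (k + 1 - 1) = 3 := by omega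
    have e2 : k + 1 + 1 + (0 + 1) - (k + 1) = 2 := by omega
    simp only [e1, e2]
    split_ifs <;> first | (exfalso; omega) | (push_cast; ring)
  · refine ⟨0, ?_⟩
    have e1 : k + 1 + 1 + (r + 1 + 1) - (k + 1 - 1) = r + 4 := by omega
    have e2 : k + 1 + 1 + (r + 1 + 1) - (k + 1) = r + 3 := by omega
    have e3 : k + 1 + 1 + (r + 1 + 1) - (k + 1 + 1) = r + 2 := by omega
    simp only [e1, e2, e3]
    split_ifs <;> first | (exfalso; omega) | (push_cast; ring)

theorem craigSpan_stable {n d : ℕ} (hd : d ∣ n + 1) (g : Equiv.Perm (Fin (n + 1)))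
    {x : Fin n → ℚ} (hx : x ∈ craigSpan n d) : craigRep n g x ∈ craigSpan n d := by
  have hgen : ∀ k : Fin n, ∀ x ∈ craigSpan n d,
      Matrix.toLin' (craigMatrix n k) x ∈ craigSpan n d := by
    intro k x hx
    induction hx using Submodule.span_induction with
    | mem x hx =>
      suffices h : ∃ m : ℤ, ∑ j, (craigCoef k j : ℚ) * x j = m * d by
        obtain ⟨m, hm⟩ := h
        rw [craigMatrix_apply, hm]
        refine add_mem (neg_mem (Submodule.subset_span hx)) ?_
        convert Submodule.smul_mem _ m (single_mem_craigSpan (d := d) k) using 1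
        ext a
        simp [Pi.single_apply]
      rcases hx with ⟨i, -, rfl⟩ | hx
      · exact ⟨craigCoef k i, by simp [Pi.single_apply]⟩
      · obtain rfl : x = craigVec n := hx
        obtain ⟨m, hm⟩ := sum_craigCoef_craigVec k
        obtain ⟨c, hc⟩ := hd
        refine ⟨m * c, hm.trans ?_⟩
        have : (n : ℚ) + 1 = d * c := by exact_mod_cast hc
        rw [this]; push_cast; ring
    | zero => simp
    | add x y _ _ hx hy => rw [map_add]; exact add_mem hx hy
    | smul c x _ hx => rw [map_zsmul]; exact Submodule.smul_mem _ c hx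
  have hg : g ∈ Submonoid.closure
      (Set.range fun i : Fin n => Equiv.swap i.castSucc i.succ) := by
    rw [Equiv.Perm.mclosure_swap_castSucc_succ]; trivial
  induction hg using Submonoid.closure_induction generalizing x with
  | mem g hg => obtain ⟨k, rfl⟩ := hg; rw [craigRep_swap]; exact hgen k x hx
  | one => simpa using hx
  | mul g h _ _ ihg ihh => rw [map_mul]; exact ihg (ihh hx)

/-- Craig's lattice `L(d) = (⨁_{i < n} ℤ d e_i) ⊕ ℤ v` in `V`, for a divisor `d` of `n + 1`. -/
def craigLattice (n d : ℕ) (hd : d ∣ n + 1) : Subrepresentation (restrictInt (craigRep n)) where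
  toSubmodule := craigSpan n d
  apply_mem_toSubmodule g _ hx := craigSpan_stable hd g hx

end SpechtCraig

end

open SpechtCraig

open scoped TensorProduct

namespace SpechtCraig

/-! ### Equivariant maps -/

/-! Both lattices are the same quotient of one lattice: ℤ^(n+1) with the permutation action twisted
by the sign, modulo the constant vectors.

On the Specht side, the polytabloid of a tableau of hook shape depends, up to sign, only on the
entry b of the second column. With a reference tableau t fixed, `spechtMap` sends the basis vector
ε_b to the signed sum of the tabloids {g t} with b in that place, which is ± such a polytabloid
(`polytabloid_smul`). It is equivariant, and its value at {h t} is ± the difference of two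
coordinates of the argument (`spechtMap_apply_mk`), so its kernel consists of the constant vectors.
Standard tableaux correspond to b ≠ 0, and the ε_b with b ≠ 0 form a basis modulo constants; hence
linear independence and `range_spechtMapInt`.

On Craig's side, `emb` realizes V inside the signed permutation module. The map x ↦ (n+1)x − (∑
x_a)(1, …, 1) has the same kernel, and its image is that of L(n+1): v goes to ± the image of one
basis vector, and (n+1)e_i to ± the image of a difference of neighbouring ones
(`map_craigSpan_eq_range_centering`). Equal kernels give the isomorphism.

For p ∣ n+1 the coordinate sum modulo p is well defined on the quotient. A stable sublattice
containing all multiples of p and some element of nonzero sum is everything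
(`eq_top_of_sum_not_dvd`), so the kernel of the sum is the only p-maximal sublattice. Finally, with
n+1 = dm and p ∤ m, L(n+1) ⊆ L(d) and m L(d) ⊆ L(n+1), so the completions at p agree. -/

/-- An equivariant linear equivalence, as an equivalence of modules over the group algebra. -/
theorem nonempty_asModule_equiv {A G V W : Type*} [CommRing A] [Group G] [AddCommGroup V]
    [Module A V] [AddCommGroup W] [Module A W] {ρ : Representation A G V}
    {σ : Representation A G W} (e : V ≃ₗ[A] W) (he : ∀ g x, e (ρ g x) = σ g (e x)) :
    Nonempty (ρ.asModule ≃ₗ[MonoidAlgebra A G] σ.asModule) := by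
  let f : ρ.asModule ≃+ σ.asModule :=
    (ρ.asModuleEquiv.trans (e.trans σ.asModuleEquiv.symm)).toAddEquiv
  refine ⟨f.toLinearEquiv fun a x => ?_⟩
  induction a using MonoidAlgebra.induction_linear with
  | zero => simp
  | add a b ha hb => rw [add_smul, add_smul, map_add, ha, hb]
  | single g c =>
    rw [Representation.single_smul, Representation.single_smul]
    exact (map_smul e c _).trans (congrArg (c • ·) (he g x))

/-- Two linear maps with the same kernel, the first one onto `M`, the second one with the same
range as an injective map `j : L → B`, induce an equivalence of `M` and `L`. -/
theorem exists_equiv_of_ker_eq {R A M L B : Type*} [CommRing R] [AddCommGroup A] [Module R A]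
    [AddCommGroup M] [Module R M] [AddCommGroup L] [Module R L] [AddCommGroup B] [Module R B]
    (f : A →ₗ[R] M) (hf : Function.Surjective f) (h : A →ₗ[R] B) (j : L →ₗ[R] B)
    (hj : Function.Injective j) (hk : LinearMap.ker f = LinearMap.ker h)
    (hr : LinearMap.range h = LinearMap.range j) :
    ∃ e : M ≃ₗ[R] L, ∀ a, j (e (f a)) = h a := by
  let e₁ := f.quotKerEquivOfSurjective hf
  let e₂ := Submodule.quotEquivOfEq _ _ hk
  let e₃ := h.quotKerEquivRange
  let e₄ := LinearEquiv.ofEq _ _ hr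
  let e₅ := LinearEquiv.ofInjective j hj
  refine ⟨e₁.symm.trans (e₂.trans (e₃.trans (e₄.trans e₅.symm))), fun a => ?_⟩
  have h1 : e₁.symm (f a) = Submodule.Quotient.mk a := by
    rw [LinearEquiv.symm_apply_eq]; rfl
  have h2 : ∀ y, j (e₅.symm y) = y := fun y => congrArg Subtype.val (e₅.apply_symm_apply y)
  simp only [LinearEquiv.trans_apply, h1, h2]
  rfl

/-- An equivariant linear map with an equivariant inverse up to a factor that is invertible in
`ℤ_p` induces an isomorphism of completions. -/
theorem nonempty_completion_equiv {p : ℕ} [Fact p.Prime] {G M L : Type*} [Group G]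
    [AddCommGroup M] [AddCommGroup L] {ρ : Representation ℤ G M} {σ : Representation ℤ G L}
    (f : M →ₗ[ℤ] L) (h : L →ₗ[ℤ] M) (m : ℤ) (hm : IsUnit (m : ℤ_[p]))
    (hfh : ∀ x, f (h x) = m • x) (hhf : ∀ x, h (f x) = m • x)
    (hf : ∀ g x, f (ρ g x) = σ g (f x)) :
    Nonempty ((completion p ρ).asModule ≃ₗ[MonoidAlgebra ℤ_[p] G] (completion p σ).asModule) := by
  obtain ⟨u, hu⟩ := hm
  refine nonempty_asModule_equiv (LinearEquiv.ofLinearMap (f.baseChange ℤ_[p])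
    ((↑u⁻¹ : ℤ_[p]) • h.baseChange ℤ_[p]) ?_ ?_) fun g x => ?_
  · ext x
    simp [hfh, ← Int.cast_smul_eq_zsmul ℤ_[p] m, ← hu, smul_smul]
  · ext x
    simp [hhf, ← Int.cast_smul_eq_zsmul ℤ_[p] m, ← hu, smul_smul]
  · induction x using TensorProduct.induction_on with
    | zero => simp
    | tmul c x => simp [completion, hf]
    | add x y hx hy => simp only [map_add, hx, hy]

/-! ### The signed permutation lattice -/

/-- The signed permutation action on `ℤ^(n+1)`. -/
def signPermInt (n : ℕ) (g : Equiv.Perm (Fin (n + 1))) (x : Fin (n + 1) → ℤ) :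
    Fin (n + 1) → ℤ := fun a => (Equiv.Perm.sign g : ℤ) * x (g⁻¹ a)

/-- Coordinatewise inclusion of `ℤ^m` in `ℚ^m`. -/
def castLin (m : ℕ) : (Fin m → ℤ) →ₗ[ℤ] (Fin m → ℚ) where
  toFun x a := x a
  map_add' x y := by ext; simp
  map_smul' c x := by ext; simp

@[simp] theorem castLin_apply (m : ℕ) (x : Fin m → ℤ) (a : Fin m) : castLin m x a = x a := rfl

theorem castLin_signPermInt (n : ℕ) (g : Equiv.Perm (Fin (n + 1))) (x : Fin (n + 1) → ℤ) :
    castLin (n + 1) (signPermInt n g x) = signPerm n g (castLin (n + 1) x) := by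
  ext a
  simp [signPermInt, signPerm, LinearMap.funLeft_apply]

/-- A submodule of `ℤ^(n+1)` that is stable under the signed action and contains `p ℤ^(n+1)`, and
an element whose coordinate sum is prime to `p`, is everything if `p` divides `n + 1`. -/
theorem eq_top_of_sum_not_dvd {n p : ℕ} [hp : Fact p.Prime] (hpn : p ∣ n + 1)
    (W : Submodule ℤ (Fin (n + 1) → ℤ)) (hW : ∀ g, ∀ x ∈ W, signPermInt n g x ∈ W)
    (hpW : ∀ x, (p : ℤ) • x ∈ W) {x : Fin (n + 1) → ℤ} (hx : x ∈ W)
    (hs : ¬ (p : ℤ) ∣ ∑ a, x a) : W = ⊤ := by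
  have hpZ : Prime (p : ℤ) := Nat.prime_iff_prime_int.mp hp.out
  -- an integer vector lies in `W` if a multiple prime to `p` does
  have hdiv : ∀ (c : ℤ) (y : Fin (n + 1) → ℤ), ¬ (p : ℤ) ∣ c → c • y ∈ W → y ∈ W := by
    intro c y hc hy
    obtain ⟨s, t, hst⟩ := (hpZ.coprime_iff_not_dvd).2 hc
    have : y = s • ((p : ℤ) • y) + t • (c • y) := by
      rw [smul_smul, smul_smul, ← add_smul, hst, one_smul]
    rw [this]
    exact W.add_mem (W.smul_mem _ (hpW y)) (W.smul_mem _ hy)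
  -- A vector that is constant mod p has sum ≡ (n+1) x_0 ≡ 0, so x is not constant mod p.
  obtain ⟨i, j, hij⟩ : ∃ i j, ¬ (p : ℤ) ∣ x i - x j := by
    by_contra! hc
    refine hs ?_
    have : ∑ a, x a = ∑ a, (x a - x 0) + (n + 1 : ℕ) * x 0 := by
      rw [Finset.sum_sub_distrib]; simp
    rw [this]
    exact dvd_add (Finset.dvd_sum fun a _ => hc a 0)
      (dvd_mul_of_dvd_left (Int.natCast_dvd_natCast.2 hpn) _)
  have hne : i ≠ j := by rintro rfl; simp at hij
  -- A transposition has sign −1, so x plus its image under (i j) is (x_i − x_j)(ε_i − ε_j).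
  have hroot : Pi.single i 1 - Pi.single j 1 ∈ W := by
    refine hdiv _ _ hij ?_
    have h := W.add_mem hx (hW (Equiv.swap i j) x hx)
    convert h using 1
    ext a
    simp only [signPermInt, Equiv.Perm.sign_swap hne, Equiv.swap_inv, Pi.smul_apply, Pi.sub_apply,
      Pi.add_apply, Pi.single_apply, Equiv.swap_apply_def, smul_eq_mul]
    split_ifs with h1 h2 h2
    · exact absurd (h1.symm.trans h2) hne
    all_goals first | (subst h1; simp; try ring) | (subst h2; simp; try ring) | simp
  have hroots : ∀ k l, Pi.single k (1 : ℤ) - Pi.single l 1 ∈ W := by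
    intro k l
    by_cases hkl : k = l
    · simp [hkl]
    obtain ⟨g, hgi, hgj⟩ : ∃ g : Equiv.Perm (Fin (n + 1)), g i = k ∧ g j = l := by
      -- The first swap takes i to k; the second takes the image of j to l and leaves k alone.
      refine ⟨Equiv.swap i k |>.trans (Equiv.swap (Equiv.swap i k j) l), ?_, by simp⟩
      rw [Equiv.trans_apply, Equiv.swap_apply_left, Equiv.swap_apply_of_ne_of_ne _ hkl]
      intro hk
      have := (Equiv.swap i k).injective ((Equiv.swap_apply_left i k).trans hk)
      exact hne this
    have h := W.smul_mem (Equiv.Perm.sign g : ℤ) (hW g _ hroot)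
    convert h using 1
    ext a
    have hk : g⁻¹ a = i ↔ a = k := by rw [Equiv.Perm.inv_eq_iff_eq, hgi]
    have hl : g⁻¹ a = j ↔ a = l := by rw [Equiv.Perm.inv_eq_iff_eq, hgj]
    simp only [signPermInt, Pi.smul_apply, Pi.sub_apply, Pi.single_apply, hk, hl, smul_eq_mul,
      ← mul_assoc]
    rw [← Units.val_mul, Int.units_mul_self]
    simp
  have hsingle : ∀ k, Pi.single k (1 : ℤ) ∈ W := by
    intro k
    refine hdiv _ _ hs ?_
    have : (∑ a, x a) • Pi.single k (1 : ℤ) =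
        x + ∑ a, x a • (Pi.single k (1 : ℤ) - Pi.single a 1) := by
      ext b
      simp [Finset.sum_apply, Pi.single_apply, mul_sub, Finset.sum_sub_distrib]
    rw [this]
    exact W.add_mem hx (W.sum_mem fun a _ => W.smul_mem _ (hroots k a))
  rw [eq_top_iff]
  intro y _
  have : y = ∑ a, y a • Pi.single a (1 : ℤ) := by
    ext b
    simp [Finset.sum_apply, Pi.single_apply]
  rw [this]
  exact W.sum_mem fun a _ => W.smul_mem _ (hsingle a)

/-- The sublattices of an equivariant quotient of `ℤ^(n+1)` by the constant vectors: there is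
exactly one `p`-maximal one, of index `p`. -/
theorem exists_unique_isPMaximal {n p : ℕ} [hp : Fact p.Prime] (hpn : p ∣ n + 1) {M : Type*}
    [AddCommGroup M] {ρ : Representation ℤ (Equiv.Perm (Fin (n + 1))) M}
    (f : (Fin (n + 1) → ℤ) →ₗ[ℤ] M) (hf : Function.Surjective f)
    (hρ : ∀ g x, ρ g (f x) = f (signPermInt n g x))
    (hker : ∀ x, f x = 0 → ∀ a b, x a = x b) :
    ∃ N : Subrepresentation ρ, (∀ N' : Subrepresentation ρ, IsPMaximal p N' ↔ N' = N) ∧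
      N.toSubmodule.toAddSubgroup.index = p := by
  let s : (Fin (n + 1) → ℤ) →ₗ[ℤ] ZMod p :=
    (Int.castAddHom (ZMod p)).toIntLinearMap ∘ₗ ∑ a, LinearMap.proj a
  have hs : ∀ x, s x = ((∑ a, x a : ℤ) : ZMod p) := fun x => by simp [s]
  have hs0 : ∀ x, s x = 0 ↔ (p : ℤ) ∣ ∑ a, x a := fun x => by
    rw [hs, ZMod.intCast_zmod_eq_zero_iff_dvd]
  -- A constant vector c has sum (n+1)c, divisible by p, so the sum mod p descends to M.
  have hsk : LinearMap.ker f ≤ LinearMap.ker s := by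
    intro x hx
    rw [LinearMap.mem_ker, hs0, Finset.sum_congr rfl fun a _ => hker x hx a 0]
    simpa using dvd_mul_of_dvd_left (Int.natCast_dvd_natCast.2 hpn) (x 0)
  have hmem : ∀ x, f x ∈ (LinearMap.ker s).map f ↔ (p : ℤ) ∣ ∑ a, x a := by
    intro x
    rw [← hs0, ← LinearMap.mem_ker, ← Submodule.mem_comap, Submodule.comap_map_eq,
      sup_eq_left.2 hsk]
  let N : Subrepresentation ρ := ⟨(LinearMap.ker s).map f, by
    intro g v hv
    obtain ⟨x, rfl⟩ := hf v
    rw [hρ, hmem]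
    rw [hmem] at hv
    simp only [signPermInt, ← Finset.mul_sum]
    rw [Equiv.sum_comp g⁻¹ x]
    exact dvd_mul_of_dvd_right hv _⟩
  have hNmem : ∀ x, f x ∈ N.toSubmodule ↔ (p : ℤ) ∣ ∑ a, x a := hmem
  have hpN : ∀ x : M, (p : ℤ) • x ∈ N.toSubmodule := by
    intro v
    obtain ⟨x, rfl⟩ := hf v
    rw [← map_smul, hNmem]
    exact Finset.dvd_sum fun a _ => by simp
  -- This one statement yields both the maximality of N and its uniqueness.
  have htop : ∀ N' : Subrepresentation ρ, (∀ x : M, (p : ℤ) • x ∈ N'.toSubmodule) →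
      ¬ N' ≤ N → N' = ⊤ := by
    intro N' hN' hle
    obtain ⟨v, hv, hvN⟩ := Set.not_subset.1 hle
    obtain ⟨x, rfl⟩ := hf v
    have h := eq_top_of_sum_not_dvd hpn (N'.toSubmodule.comap f)
      (fun g y hy => by
        rw [Submodule.mem_comap, ← hρ]; exact N'.apply_mem_toSubmodule g hy)
      (fun y => by rw [Submodule.mem_comap, map_smul]; exact hN' _)
      (show x ∈ _ from hv) (fun hd => hvN ((hNmem x).2 hd))
    refine Subrepresentation.toSubmodule_injective (eq_top_iff.2 fun w _ => ?_)
    obtain ⟨y, rfl⟩ := hf w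
    have : y ∈ N'.toSubmodule.comap f := h ▸ Submodule.mem_top
    exact this
  have hNtop : N ≠ ⊤ := by
    intro h
    have h1 : f (Pi.single 0 1) ∈ N.toSubmodule := h ▸ (Submodule.mem_top : _ ∈ (⊤ : Submodule ℤ M))
    rw [hNmem] at h1
    simp only [Finset.sum_pi_single', Finset.mem_univ, if_true] at h1
    exact (Nat.prime_iff_prime_int.mp hp.out).not_dvd_one h1
  have hNco : IsCoatom N := by
    refine ⟨hNtop, fun N' h => htop N' (fun x => ?_) (not_le_of_gt h)⟩
    exact h.le (hpN x)
  refine ⟨N, fun N' => ⟨fun h => ?_, ?_⟩, ?_⟩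
  · by_cases hle : N' ≤ N
    · exact (h.1.le_iff_eq hNtop).1 hle |>.symm
    · exact absurd (htop N' h.2 hle) h.1.1
  · rintro rfl
    exact ⟨hNco, hpN⟩
  -- The index is computed upstairs, where the preimage of N is the kernel of a surjection onto ℤ/p.
  · have h1 : N.toSubmodule.toAddSubgroup.comap f.toAddMonoidHom = s.toAddMonoidHom.ker := by
      ext x
      rw [AddSubgroup.mem_comap, AddMonoidHom.mem_ker]
      exact (hNmem x).trans (hs0 x).symm
    have hsurj : Function.Surjective s.toAddMonoidHom := by
      intro c
      obtain ⟨z, rfl⟩ := ZMod.intCast_surjective c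
      exact ⟨Pi.single 0 z, (hs _).trans (by simp)⟩
    rw [← AddSubgroup.index_comap_of_surjective _ (f := f.toAddMonoidHom) hf, h1,
      AddSubgroup.index_ker, AddMonoidHom.range_eq_top.2 hsurj]
    simp

/-! ### Craig's lattices -/

/-- Adjacent transpositions generate the group, so the check on them suffices. -/
theorem emb_craigRep (n : ℕ) (g : Equiv.Perm (Fin (n + 1))) (x : Fin n → ℚ) :
    emb n (craigRep n g x) = signPerm n g (emb n x) := by
  have hg : g ∈ Submonoid.closure
      (Set.range fun i : Fin n => Equiv.swap i.castSucc i.succ) := by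
    rw [Equiv.Perm.mclosure_swap_castSucc_succ]; trivial
  induction hg using Submonoid.closure_induction generalizing x with
  | mem g hg => obtain ⟨k, rfl⟩ := hg; rw [craigRep_swap, signPerm_emb]
  | one => simp
  | mul g h _ _ ihg ihh =>
    rw [map_mul, map_mul, Module.End.mul_apply, ihg, ihh, Module.End.mul_apply]

/-- The map `x ↦ (n + 1) x - (∑ x_a) (1, …, 1)`. -/
def centering (n : ℕ) : (Fin (n + 1) → ℤ) →ₗ[ℤ] (Fin (n + 1) → ℚ) :=
  castLin (n + 1) ∘ₗ (((n : ℤ) + 1) • LinearMap.id -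
    (∑ a, LinearMap.proj a).smulRight (fun _ => (1 : ℤ)))

theorem centering_apply (n : ℕ) (x : Fin (n + 1) → ℤ) (a : Fin (n + 1)) :
    centering n x a = ((n : ℚ) + 1) * x a - ∑ b, (x b : ℚ) := by
  simp [centering]
  ring

theorem mem_ker_centering {n : ℕ} {x : Fin (n + 1) → ℤ} :
    x ∈ LinearMap.ker (centering n) ↔ ∀ a b, x a = x b := by
  rw [LinearMap.mem_ker]
  constructor
  · intro h a b
    have ha := congrFun h a
    have hb := congrFun h b
    rw [centering_apply] at ha hb
    have h0 : ((n : ℚ) + 1) * x a = ((n : ℚ) + 1) * x b := by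
      simp only [Pi.zero_apply] at ha hb; linarith
    exact_mod_cast mul_left_cancel₀ (by positivity) h0
  · intro h
    ext a
    rw [centering_apply, Finset.sum_congr rfl fun b _ => by rw [h b a]]
    simp

theorem centering_signPermInt (n : ℕ) (g : Equiv.Perm (Fin (n + 1))) (x : Fin (n + 1) → ℤ) :
    centering n (signPermInt n g x) = signPerm n g (centering n x) := by
  ext a
  simp only [centering_apply, signPermInt, signPerm, MonoidHom.coe_mk, OneHom.coe_mk,
    LinearMap.smul_apply, Pi.smul_apply, LinearMap.funLeft_apply, smul_eq_mul]
  push_cast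
  rw [← Finset.mul_sum, Equiv.sum_comp g⁻¹ fun b => (x b : ℚ)]
  ring

/-! ### The image of L(n+1) in the signed permutation module -/

theorem emb_apply_eq_sum (n : ℕ) (x : Fin n → ℚ) (a : Fin (n + 1)) :
    emb n x a = ∑ j : Fin n, x j * ((-1) ^ (j : ℕ) *
      ((if a = j.castSucc then 1 else 0) - if a = j.succ then 1 else 0)) := by
  simp [emb, Fintype.linearCombination_apply, Finset.sum_apply, Pi.single_apply]

/-- Only two neighbouring basis vectors contribute to a coordinate; the last coordinate gets just
one, whence the case distinction. -/
theorem emb_succ (n : ℕ) (x : Fin n → ℚ) (i : Fin n) :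
    emb n x i.succ = (if h : (i : ℕ) + 1 < n then (-1) ^ ((i : ℕ) + 1) * x ⟨i + 1, h⟩ else 0) -
      (-1) ^ (i : ℕ) * x i := by
  rw [emb_apply_eq_sum]
  simp only [mul_sub, Finset.sum_sub_distrib]
  congr 1
  · split_ifs with h
    · rw [Finset.sum_eq_single ⟨i + 1, h⟩]
      · rw [if_pos (by ext; simp)]; simp; ring
      · intro b _ hb
        rw [if_neg (fun h' => hb (Fin.ext (by simpa using (congrArg Fin.val h').symm)))]; simp
      · simp
    · refine Finset.sum_eq_zero fun b _ => ?_
      rw [if_neg (fun h' => h (by have := congrArg Fin.val h'; simp at this; omega))]; simp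
  · simp [Fin.succ_inj]; ring

theorem emb_zero (n : ℕ) (x : Fin n → ℚ) (h : 0 < n) : emb n x 0 = x ⟨0, h⟩ := by
  rw [emb_apply_eq_sum, Finset.sum_eq_single ⟨0, h⟩]
  · simp [Fin.ext_iff]
  · intro b _ hb
    have : (b : ℕ) ≠ 0 := fun h' => hb (Fin.ext h')
    simp [Fin.ext_iff, this.symm]
  · simp

/-- The image of `v` is `± (1 - (n + 1) ε_n)`. -/
theorem emb_craigVec (n : ℕ) (hn : 2 ≤ n) (l : Fin n) (hl : (l : ℕ) + 1 = n) :
    emb n (craigVec n) = (-1 : ℤ) ^ (n + 1) • centering n (Pi.single l.castSucc 1) := by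
  ext a
  simp only [Pi.smul_apply, centering_apply]
  rw [show ∑ b, ((Pi.single l.castSucc (1 : ℤ) : Fin (n + 1) → ℤ) b : ℚ) = 1 by
    simp [Pi.single_apply]]
  induction a using Fin.cases with
  | zero =>
    rw [emb_zero n _ (by omega), craigVec, if_neg (by simp; omega),
      Pi.single_eq_of_ne (by simp [Fin.ext_iff]; omega)]
    simp [pow_succ]
  | succ i =>
    obtain ⟨i, hi⟩ := i
    rw [emb_succ]
    simp only [craigVec]
    by_cases h1 : i + 1 = n
    · subst h1
      rw [dif_neg (by simp), if_pos rfl, Pi.single_eq_of_ne (by simp [Fin.ext_iff]; omega)]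
      simp [pow_succ]
    · have hlt : i + 1 < n := by omega
      obtain ⟨r, rfl⟩ : ∃ r, n = i + 2 + r := ⟨n - (i + 2), by omega⟩
      rw [dif_pos hlt, if_neg h1, show i + 2 + r - i = r + 2 by omega]
      -- The case r = 0 is the coordinate of the distinguished basis vector, where centering gives
      -- (n+1) − 1 instead of −1.
      by_cases h2 : r = 0
      · subst h2
        rw [show Fin.succ ⟨i, hi⟩ = l.castSucc from Fin.ext (by simp; omega)]
        simp [pow_succ]
        ring
      · rw [if_neg (by simp; omega), show i + 2 + r - (i + 1) = r + 1 by omega,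
          Pi.single_eq_of_ne (by simp [Fin.ext_iff]; omega)]
        simp only [zsmul_eq_mul]
        push_cast
        ring

/-- The coordinate sum vanishes, so only the factor n+1 survives; this is why d = n+1 is the right
divisor. -/
theorem centering_sub (n : ℕ) (k l : Fin (n + 1)) :
    centering n (Pi.single k 1 - Pi.single l 1) =
      ((n : ℚ) + 1) • (Pi.single k 1 - Pi.single l 1) := by
  ext a
  simp [centering_apply, Pi.single_apply]

theorem emb_single_smul (n : ℕ) (i : Fin n) :
    emb n (Pi.single i ((n + 1 : ℕ) : ℚ)) =
      (-1 : ℤ) ^ (i : ℕ) • centering n (Pi.single i.castSucc 1 - Pi.single i.succ 1) := by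
  have : (Pi.single i ((n + 1 : ℕ) : ℚ) : Fin n → ℚ) = ((n : ℚ) + 1) • Pi.single i 1 := by
    ext a; simp [Pi.single_apply]
  rw [this, map_smul, emb_single, centering_sub, smul_comm]
  ext a
  simp

theorem map_craigSpan_eq_range_centering (n : ℕ) (hn : 2 ≤ n) :
    (craigSpan n (n + 1)).map ((emb n).restrictScalars ℤ) = LinearMap.range (centering n) := by
  obtain ⟨l, hl⟩ : ∃ l : Fin n, (l : ℕ) + 1 = n := ⟨⟨n - 1, by omega⟩, by simp; omega⟩
  apply le_antisymm
  · rw [Submodule.map_le_iff_le_comap, craigSpan, Submodule.span_le]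
    rintro _ (⟨i, -, rfl⟩ | rfl)
    · change emb n (Pi.single i _) ∈ LinearMap.range (centering n)
      rw [emb_single_smul]
      exact Submodule.smul_mem _ _ ⟨_, rfl⟩
    · change emb n (craigVec n) ∈ LinearMap.range (centering n)
      rw [emb_craigVec n hn l hl]
      exact Submodule.smul_mem _ _ ⟨_, rfl⟩
  · set W := (craigSpan n (n + 1)).map ((emb n).restrictScalars ℤ)
    have hunit : ∀ (k : ℕ) (y : Fin (n + 1) → ℚ), (-1 : ℤ) ^ k • y ∈ W → y ∈ W := by
      intro k y hy
      have h := W.smul_mem ((-1 : ℤ) ^ k) hy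
      rwa [smul_smul, ← mul_pow, neg_one_mul, neg_neg, one_pow, one_smul] at h
    have hdiff : ∀ i : Fin n,
        centering n (Pi.single i.castSucc 1) - centering n (Pi.single i.succ 1) ∈ W := by
      intro i
      rw [← map_sub]
      exact hunit i _ (emb_single_smul n i ▸ ⟨_, single_mem_craigSpan i, rfl⟩)
    have hvec : centering n (Pi.single l.castSucc 1) ∈ W :=
      hunit (n + 1) _ (emb_craigVec n hn l hl ▸ ⟨_, Submodule.subset_span (Or.inr rfl), rfl⟩)
    -- The vector v supplies one basis vector (up to sign), and the neighbouring differences reach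
    -- all the others, starting from the last.
    have hall : ∀ a, centering n (Pi.single a 1) ∈ W := by
      intro a
      induction a using Fin.reverseInduction with
      | last =>
        rw [show Fin.last n = l.succ from Fin.ext (by simp [hl])]
        simpa using W.sub_mem hvec (hdiff l)
      | cast i hi => simpa using W.add_mem (hdiff i) hi
    rintro _ ⟨x, rfl⟩
    have : x = ∑ a, x a • Pi.single a (1 : ℤ) := by
      ext b
      simp [Finset.sum_apply, Pi.single_apply]
    rw [this, map_sum]
    exact W.sum_mem fun a _ => by rw [map_smul]; exact W.smul_mem _ (hall a)

/-- Craig's lattices `L(n + 1)` and `L(d)` have isomorphic completions at `p` if `(n + 1) / d` is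
prime to `p`. -/
theorem nonempty_completion_craigLattice {n p d m : ℕ} [hp : Fact p.Prime] (hdm : d * m = n + 1)
    (hm : ¬ p ∣ m) (hd : d ∣ n + 1) {M : Type*} [AddCommGroup M]
    {ρ : Representation ℤ (Equiv.Perm (Fin (n + 1))) M}
    (e : M ≃ₗ[ℤ] (craigLattice n (n + 1) dvd_rfl).toSubmodule)
    (he : ∀ g x, e (ρ g x) = (craigLattice n (n + 1) dvd_rfl).toRepresentation g (e x)) :
    Nonempty ((completion p ρ).asModule ≃ₗ[MonoidAlgebra ℤ_[p] (Equiv.Perm (Fin (n + 1)))]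
      (completion p (craigLattice n d hd).toRepresentation).asModule) := by
  have hle : craigSpan n (n + 1) ≤ craigSpan n d := by
    rw [craigSpan, Submodule.span_le]
    rintro _ (⟨i, -, rfl⟩ | rfl)
    · have : (Pi.single i ((n + 1 : ℕ) : ℚ) : Fin n → ℚ) = (m : ℤ) • Pi.single i (d : ℚ) := by
        ext a
        simp only [← hdm, Pi.single_apply, Pi.smul_apply]
        split_ifs <;> simp [mul_comm]
      rw [this]
      exact Submodule.smul_mem _ _ (single_mem_craigSpan i)
    · exact Submodule.subset_span (Or.inr rfl)
  have hge : ∀ x ∈ craigSpan n d, (m : ℤ) • x ∈ craigSpan n (n + 1) := by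
    suffices h : craigSpan n d ≤
        (craigSpan n (n + 1)).comap ((m : ℤ) • LinearMap.id) from fun x hx => h hx
    rw [craigSpan, Submodule.span_le]
    rintro _ (⟨i, -, rfl⟩ | rfl)
    · have : (Pi.single i ((n + 1 : ℕ) : ℚ) : Fin n → ℚ) = (m : ℤ) • Pi.single i (d : ℚ) := by
        ext a
        simp only [← hdm, Pi.single_apply, Pi.smul_apply]
        split_ifs <;> simp [mul_comm]
      change (m : ℤ) • Pi.single i (d : ℚ) ∈ craigSpan n (n + 1)
      exact this ▸ single_mem_craigSpan i
    · change (m : ℤ) • craigVec n ∈ craigSpan n (n + 1)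
      exact Submodule.smul_mem _ _ (Submodule.subset_span (Or.inr rfl))
  let ι : (craigLattice n (n + 1) dvd_rfl).toSubmodule →ₗ[ℤ] (craigLattice n d hd).toSubmodule :=
    Submodule.inclusion hle
  let κ : (craigLattice n d hd).toSubmodule →ₗ[ℤ] (craigLattice n (n + 1) dvd_rfl).toSubmodule :=
    ((m : ℤ) • LinearMap.id).restrict hge
  have hικ : ∀ x, ι (κ x) = (m : ℤ) • x := fun x => rfl
  have hκι : ∀ x, κ (ι x) = (m : ℤ) • x := fun x => rfl
  refine nonempty_completion_equiv (ι ∘ₗ e.toLinearMap) (e.symm.toLinearMap ∘ₗ κ) m ?_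
    (fun x => ?_) (fun x => ?_) fun g x => ?_
  -- An integer prime to p is a unit of ℤ_p.
  · by_contra h
    rw [← mem_nonunits_iff, PadicInt.mem_nonunits, PadicInt.norm_int_lt_one_iff_dvd] at h
    exact hm (Int.natCast_dvd_natCast.1 h)
  · simp [hικ]
  · simp [hκι]
  · simp only [LinearMap.comp_apply, LinearEquiv.coe_coe, he]
    rfl

/-! ### Tableaux of hook shape -/

theorem mem_hook {n : ℕ} (hn : 1 ≤ n) {c : ℕ × ℕ} :
    c ∈ hook n ↔ c = (0, 1) ∨ c.2 = 0 ∧ c.1 < n := by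
  obtain ⟨i, j⟩ := c
  rw [hook, YoungDiagram.mem_ofRowLens]
  rcases i with _ | i
  · simp; omega
  · simp; omega

/-- The cell in column `1`. -/
def armCell {n : ℕ} (hn : 1 ≤ n) : {c : ℕ × ℕ // c ∈ hook n} :=
  ⟨(0, 1), (mem_hook hn).2 (Or.inl rfl)⟩

/-- The cells in column `0`. -/
def legCell {n : ℕ} (hn : 1 ≤ n) (i : Fin n) : {c : ℕ × ℕ // c ∈ hook n} :=
  ⟨(i, 0), (mem_hook hn).2 (Or.inr ⟨rfl, i.2⟩)⟩

theorem cell_cases {n : ℕ} (hn : 1 ≤ n) (c : {c : ℕ × ℕ // c ∈ hook n}) :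
    c = armCell hn ∨ ∃ i, c = legCell hn i := by
  obtain ⟨⟨i, j⟩, hc⟩ := c
  rcases (mem_hook hn).1 hc with h | ⟨h1, h2⟩
  · exact Or.inl (Subtype.ext h)
  · exact Or.inr ⟨⟨i, h2⟩, Subtype.ext (Prod.ext rfl h1)⟩

/-- The cells of the hook are those in column `0` and one more. -/
noncomputable def hookEquiv {n : ℕ} (hn : 1 ≤ n) : Option (Fin n) ≃ {c : ℕ × ℕ // c ∈ hook n} :=
  Equiv.ofBijective (fun o => o.elim (armCell hn) (legCell hn)) (by
    constructor
    · rintro (_ | i) (_ | j) h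
      · rfl
      · simp [armCell, legCell] at h
      · simp [armCell, legCell] at h
      · simp only [Option.elim_some, legCell, Subtype.mk.injEq, Prod.mk.injEq, and_true] at h
        rw [Fin.ext h]
    · intro c
      rcases cell_cases hn c with rfl | ⟨i, rfl⟩
      · exact ⟨none, rfl⟩
      · exact ⟨some i, rfl⟩)

namespace Tableau

variable {n : ℕ} (hn : 1 ≤ n)

/-- The entry in column `1`. -/
def arm (t : Tableau (hook n) (n + 1)) : Fin (n + 1) := t.entry (armCell hn)

/-- The tableau with entry `b` in column `1` in which column `0` increases. -/
noncomputable def ofArm (b : Fin (n + 1)) : Tableau (hook n) (n + 1) :=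
  (hookEquiv hn).symm.trans (finSuccEquiv' b).symm

theorem ofArm_armCell (b : Fin (n + 1)) : (ofArm hn b).entry (armCell hn) = b := by
  change (finSuccEquiv' b).symm ((hookEquiv hn).symm (hookEquiv hn none)) = b
  simp

theorem ofArm_legCell (b : Fin (n + 1)) (i : Fin n) :
    (ofArm hn b).entry (legCell hn i) = b.succAbove i := by
  change (finSuccEquiv' b).symm ((hookEquiv hn).symm (hookEquiv hn (some i))) = _
  simp

theorem entry_injective (t : Tableau (hook n) (n + 1)) : Function.Injective t.entry :=
  Equiv.injective t

theorem ext_entry {t t' : Tableau (hook n) (n + 1)} (h : ∀ c, t.entry c = t'.entry c) : t = t' :=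
  Equiv.ext h

theorem isStandard_ofArm {b : Fin (n + 1)} (hb : b ≠ 0) : (ofArm hn b).IsStandard := by
  constructor
  · intro c c' h h'
    rcases cell_cases hn c with rfl | ⟨i, rfl⟩ <;> rcases cell_cases hn c' with rfl | ⟨j, rfl⟩
    · simp [armCell] at h'
    · simp [armCell, legCell] at h'
    · have hi : i = ⟨0, hn⟩ := Fin.ext h
      rw [ofArm_armCell, ofArm_legCell, hi, Fin.succAbove_of_castSucc_lt]
      · exact Fin.pos_iff_ne_zero.2 hb
      · exact Fin.pos_iff_ne_zero.2 hb
    · simp [legCell] at h'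
  · intro c c' h h'
    rcases cell_cases hn c with rfl | ⟨i, rfl⟩ <;> rcases cell_cases hn c' with rfl | ⟨j, rfl⟩
    · simp [armCell] at h'
    · simp [armCell, legCell] at h
    · simp [armCell, legCell] at h
    · rw [ofArm_legCell, ofArm_legCell]
      exact Fin.strictMono_succAbove b h'

/-- Column 0 lists the complement of the arm entry in increasing order, and a strictly increasing
map is determined by its range. -/
theorem eq_ofArm {T : Tableau (hook n) (n + 1)} (hT : T.IsStandard) : T = ofArm hn (T.arm hn) := by
  have hmono : StrictMono fun i => T.entry (legCell hn i) := fun i j h => hT.2 _ _ rfl h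
  have hrange : Set.range (fun i => T.entry (legCell hn i)) =
      Set.range (T.arm hn).succAbove := by
    rw [Fin.range_succAbove]
    ext a
    simp only [Set.mem_range, Set.mem_compl_iff, Set.mem_singleton_iff]
    constructor
    · rintro ⟨i, rfl⟩ h
      have := entry_injective T h
      simp [armCell, legCell] at this
    · intro ha
      obtain ⟨c, rfl⟩ : ∃ c, T.entry c = a := Equiv.surjective T a
      rcases cell_cases hn c with rfl | ⟨i, rfl⟩
      · exact absurd rfl ha
      · exact ⟨i, rfl⟩
  have h := (hmono.range_inj (Fin.strictMono_succAbove _)).1 hrange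
  refine ext_entry fun c => ?_
  rcases cell_cases hn c with rfl | ⟨i, rfl⟩
  · rw [ofArm_armCell]; rfl
  · rw [ofArm_legCell]; exact congrFun h i

theorem arm_ne_zero {T : Tableau (hook n) (n + 1)} (hT : T.IsStandard) : T.arm hn ≠ 0 := by
  have h := hT.1 (legCell hn ⟨0, hn⟩) (armCell hn) rfl (by simp [legCell, armCell])
  exact (lt_of_le_of_lt (Fin.zero_le _) h).ne'

/-! ### Column stabilizers and row equivalence for hooks -/

theorem arm_smul (g : Equiv.Perm (Fin (n + 1))) (t : Tableau (hook n) (n + 1)) :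
    (g • t).arm hn = g (t.arm hn) := rfl

theorem exists_smul_eq (t T : Tableau (hook n) (n + 1)) :
    ∃ g : Equiv.Perm (Fin (n + 1)), g • t = T :=
  ⟨Equiv.trans (Equiv.symm t) T, Equiv.ext fun c =>
    congrArg (Equiv.toFun T) (Equiv.symm_apply_apply t c)⟩

theorem col_entry (t : Tableau (hook n) (n + 1)) (c) : t.col (t.entry c) = c.1.2 :=
  congrArg (fun c => c.1.2) (Equiv.symm_apply_apply t c)

theorem row_entry (t : Tableau (hook n) (n + 1)) (c) : t.row (t.entry c) = c.1.1 :=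
  congrArg (fun c => c.1.1) (Equiv.symm_apply_apply t c)

theorem exists_entry (t : Tableau (hook n) (n + 1)) (a : Fin (n + 1)) : ∃ c, t.entry c = a :=
  Equiv.surjective t a

theorem col_eq_ite (t : Tableau (hook n) (n + 1)) (a : Fin (n + 1)) :
    t.col a = if a = t.arm hn then 1 else 0 := by
  obtain ⟨c, rfl⟩ := t.exists_entry a
  rw [col_entry]
  rcases cell_cases hn c with rfl | ⟨i, rfl⟩
  · exact (if_pos rfl).symm
  · rw [if_neg]
    · rfl
    · intro h
      have := entry_injective t h
      simp [armCell, legCell] at this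

theorem mem_colStabilizer {t : Tableau (hook n) (n + 1)} {π : Equiv.Perm (Fin (n + 1))} :
    π ∈ t.colStabilizer ↔ π (t.arm hn) = t.arm hn := by
  constructor
  · intro h
    have := h (t.arm hn)
    rw [col_eq_ite hn, col_eq_ite hn, if_pos rfl] at this
    by_contra hne
    rw [if_neg hne] at this
    exact zero_ne_one this
  · intro h a
    have : π a = t.arm hn ↔ a = t.arm hn := by
      conv_lhs => rw [← h]
      exact π.injective.eq_iff
    rw [col_eq_ite hn, col_eq_ite hn]
    simp only [this]

/-- The entry in the corner. -/
def corner (t : Tableau (hook n) (n + 1)) : Fin (n + 1) := t.entry (legCell hn ⟨0, hn⟩)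

theorem corner_ne_arm (t : Tableau (hook n) (n + 1)) : t.corner hn ≠ t.arm hn := by
  intro h
  have := entry_injective t h
  simp [armCell, legCell] at this

theorem row_eq_row_iff {t : Tableau (hook n) (n + 1)} {a b : Fin (n + 1)} :
    t.row a = t.row b ↔ a = b ∨ (a = t.corner hn ∧ b = t.arm hn) ∨
      (a = t.arm hn ∧ b = t.corner hn) := by
  constructor
  · obtain ⟨c, rfl⟩ := t.exists_entry a
    obtain ⟨d, rfl⟩ := t.exists_entry b
    rw [row_entry, row_entry]
    rcases cell_cases hn c with rfl | ⟨i, rfl⟩ <;> rcases cell_cases hn d with rfl | ⟨j, rfl⟩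
    · exact fun _ => Or.inl rfl
    · intro h
      obtain rfl : j = ⟨0, hn⟩ := Fin.ext h.symm
      exact Or.inr (Or.inr ⟨rfl, rfl⟩)
    · intro h
      obtain rfl : i = ⟨0, hn⟩ := Fin.ext h
      exact Or.inr (Or.inl ⟨rfl, rfl⟩)
    · intro h
      obtain rfl : i = j := Fin.ext h
      exact Or.inl rfl
  · rintro (rfl | ⟨rfl, rfl⟩ | ⟨rfl, rfl⟩)
    · rfl
    · exact (row_entry t (legCell hn ⟨0, hn⟩)).trans (row_entry t (armCell hn)).symm
    · exact (row_entry t (armCell hn)).trans (row_entry t (legCell hn ⟨0, hn⟩)).symm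

/-- Only the first row has more than one cell, namely two, so the row stabilizer of t has order 2,
generated by the swap of corner and arm. -/
theorem mk_smul_eq_iff {t : Tableau (hook n) (n + 1)} {g h : Equiv.Perm (Fin (n + 1))} :
    Tabloid.mk (g • t) = Tabloid.mk (h • t) ↔
      g = h ∨ g = h * Equiv.swap (t.corner hn) (t.arm hn) := by
  have hne := t.corner_ne_arm hn
  have h1 : Tabloid.mk (g • t) = Tabloid.mk (h • t) ↔ ∀ a, t.row ((h⁻¹ * g) a) = t.row a := by
    refine Quotient.eq.trans ⟨fun H a => ?_, fun H a => ?_⟩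
    · have := H (g a)
      rw [row_smul, row_smul, ← Equiv.Perm.mul_apply, inv_mul_cancel] at this
      exact this.symm
    · rw [row_smul, row_smul, ← H (g⁻¹ a)]
      simp
  have h2 : (g = h ∨ g = h * Equiv.swap (t.corner hn) (t.arm hn)) ↔
      (h⁻¹ * g = 1 ∨ h⁻¹ * g = Equiv.swap (t.corner hn) (t.arm hn)) := by
    rw [inv_mul_eq_one, inv_mul_eq_iff_eq_mul, eq_comm]
  rw [h1, h2]
  generalize h⁻¹ * g = k
  constructor
  · intro H
    simp only [row_eq_row_iff hn] at H
    have hc := H (t.corner hn)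
    have ha := H (t.arm hn)
    have hk := k.injective.ne hne
    by_cases hfix : k (t.corner hn) = t.corner hn
    · left
      ext a : 1
      have h' := H a
      rcases h' with h' | ⟨h', rfl⟩ | ⟨h', rfl⟩
      · exact h'
      · exact absurd (hfix.trans h'.symm) hk
      · exact absurd (hfix.symm.trans h') hne
    · right
      have hc' : k (t.corner hn) = t.arm hn := by tauto
      have ha' : k (t.arm hn) = t.corner hn := by
        rcases ha with h' | h' | h'
        · exact absurd (hc'.trans h'.symm) hk
        · exact h'.1
        · exact absurd h'.2.symm hne
      ext a : 1
      rw [Equiv.swap_apply_def]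
      split_ifs with h3 h4
      · rw [h3, hc']
      · rw [h4, ha']
      · have := H a
        tauto
  · rintro (rfl | rfl) a
    · rfl
    · rw [row_eq_row_iff hn, Equiv.swap_apply_def]
      split_ifs <;> tauto

end Tableau

/-! ### The Specht lattice of hook shape -/

variable {n : ℕ} (hn : 1 ≤ n)

/-- The map `ℚ^(n+1) → M^λ` that sends the basis vector `ε_b` to the signed sum of all tabloids
`{g t}` with `b` in column `1` of `g t`. -/
noncomputable def spechtMap (t : Tableau (hook n) (n + 1)) :
    (Fin (n + 1) → ℚ) →ₗ[ℚ] (Tabloid (hook n) (n + 1) →₀ ℚ) :=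
  ∑ g : Equiv.Perm (Fin (n + 1)), (LinearMap.proj (g (t.arm hn))).smulRight
    (Finsupp.single (Tabloid.mk (g • t)) (((Equiv.Perm.sign g : ℤˣ) : ℤ) : ℚ))

theorem spechtMap_apply (t : Tableau (hook n) (n + 1)) (x : Fin (n + 1) → ℚ) :
    spechtMap hn t x = ∑ g : Equiv.Perm (Fin (n + 1)),
      Finsupp.single (Tabloid.mk (g • t)) (x (g (t.arm hn)) * ((Equiv.Perm.sign g : ℤ) : ℚ)) := by
  simp [spechtMap]

/-- Translating the summation index by g produces a second factor sgn(g), which cancels the sign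
twist. -/
theorem spechtMap_signPerm (t : Tableau (hook n) (n + 1)) (g : Equiv.Perm (Fin (n + 1)))
    (x : Fin (n + 1) → ℚ) :
    spechtMap hn t (signPerm n g x) = permModule (hook n) (n + 1) g (spechtMap hn t x) := by
  rw [spechtMap_apply, spechtMap_apply, map_sum, ← Equiv.sum_comp (Equiv.mulLeft g)]
  refine Finset.sum_congr rfl fun k _ => ?_
  simp only [permModule, signPerm, MonoidHom.coe_mk, OneHom.coe_mk, Finsupp.lmapDomain_apply,
    Finsupp.mapDomain_single, Tabloid.smul_mk, Equiv.coe_mulLeft, mul_smul, LinearMap.smul_apply,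
    Pi.smul_apply, LinearMap.funLeft_apply, smul_eq_mul, map_mul, Equiv.Perm.mul_apply,
    Equiv.Perm.inv_def, Equiv.symm_apply_apply]
  congr 1
  have h : ((Equiv.Perm.sign g : ℤ) : ℚ) * ((Equiv.Perm.sign g : ℤ) : ℚ) = 1 := by
    rw [← Int.cast_mul, ← Units.val_mul, Int.units_mul_self]; simp
  push_cast
  linear_combination (x (k (t.arm hn)) * ((Equiv.Perm.sign k : ℤ) : ℚ)) * h

/-- Exactly two group elements give the tabloid {h t}. They differ by a transposition, hence have
opposite signs. -/
theorem spechtMap_apply_mk (t : Tableau (hook n) (n + 1)) (h : Equiv.Perm (Fin (n + 1)))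
    (x : Fin (n + 1) → ℚ) :
    spechtMap hn t x (Tabloid.mk (h • t)) =
      ((Equiv.Perm.sign h : ℤ) : ℚ) * (x (h (t.arm hn)) - x (h (t.corner hn))) := by
  classical
  have hne := t.corner_ne_arm hn
  rw [spechtMap_apply, Finsupp.finsetSum_apply]
  simp only [Finsupp.single_apply, Tableau.mk_smul_eq_iff hn]
  rw [← Finset.sum_filter, Finset.filter_or, Finset.sum_union, Finset.filter_eq', Finset.filter_eq']
  · simp [Equiv.Perm.sign_swap hne]
    ring
  · rw [Finset.disjoint_filter]
    rintro g - rfl hg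
    exact hne (Equiv.swap_eq_one_iff.1 (left_eq_mul.1 hg))

/-- By double transitivity, every pair of distinct entries occurs as arm and corner of some g t, so
vanishing at all tabloids equates all coordinates. -/
theorem spechtMap_eq_zero_iff (t : Tableau (hook n) (n + 1)) {x : Fin (n + 1) → ℚ} :
    spechtMap hn t x = 0 ↔ ∀ a b, x a = x b := by
  constructor
  · intro h a b
    by_cases hab : a = b
    · rw [hab]
    obtain ⟨g, hga, hgb⟩ : ∃ g : Equiv.Perm (Fin (n + 1)),
        g (t.arm hn) = a ∧ g (t.corner hn) = b := by
      refine ⟨(Equiv.swap (t.arm hn) a).trans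
        (Equiv.swap (Equiv.swap (t.arm hn) a (t.corner hn)) b), ?_, by simp⟩
      rw [Equiv.trans_apply, Equiv.swap_apply_left, Equiv.swap_apply_of_ne_of_ne _ hab]
      intro hk
      have := (Equiv.swap (t.arm hn) a).injective ((Equiv.swap_apply_left _ a).trans hk)
      exact t.corner_ne_arm hn this.symm
    have h1 := DFunLike.congr_fun h (Tabloid.mk (g • t))
    rw [spechtMap_apply_mk, hga, hgb] at h1
    have h2 : ((Equiv.Perm.sign g : ℤ) : ℚ) ≠ 0 := by simp
    exact sub_eq_zero.1 ((mul_eq_zero.1 h1).resolve_left h2)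
  · intro h
    ext ⟨T⟩
    obtain ⟨g, rfl⟩ := t.exists_smul_eq T
    change spechtMap hn t x (Tabloid.mk (g • t)) = 0
    rw [spechtMap_apply_mk, h _ (g (t.corner hn)), sub_self, mul_zero]

theorem polytabloid_smul (t : Tableau (hook n) (n + 1)) (h : Equiv.Perm (Fin (n + 1))) :
    polytabloid (h • t) =
      (Equiv.Perm.sign h : ℤ) • spechtMap hn t (Pi.single (h (t.arm hn)) 1) := by
  classical
  -- With g = π h, the condition that g moves the arm of t to that of h t says that π fixes the arm
  -- of h t, which for a hook means that π lies in its column stabilizer.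
  rw [spechtMap_apply, polytabloid, ← Equiv.sum_comp (Equiv.mulRight h), Finset.smul_sum,
    Finset.sum_filter]
  refine Finset.sum_congr rfl fun π _ => ?_
  simp only [Tableau.mem_colStabilizer hn, Tableau.arm_smul, Equiv.coe_mulRight, mul_smul,
    Equiv.Perm.mul_apply, Pi.single_apply, map_mul]
  split_ifs
  · rw [Finsupp.smul_single]
    congr 1
    have h : ((Equiv.Perm.sign h : ℤ) : ℚ) * ((Equiv.Perm.sign h : ℤ) : ℚ) = 1 := by
      rw [← Int.cast_mul, ← Units.val_mul, Int.units_mul_self]; simp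
    rw [zsmul_eq_mul]
    push_cast
    linear_combination (-((Equiv.Perm.sign π : ℤ) : ℚ)) * h
  · simp

theorem exists_polytabloid_eq (t T : Tableau (hook n) (n + 1)) :
    ∃ u : ℤˣ, polytabloid T = (u : ℤ) • spechtMap hn t (Pi.single (T.arm hn) 1) := by
  obtain ⟨h, rfl⟩ := t.exists_smul_eq T
  exact ⟨_, polytabloid_smul hn t h⟩

theorem linearIndependent_polytabloid (hn : 1 ≤ n) :
    LinearIndependent ℚ
      (fun T : {T : Tableau (hook n) (n + 1) // T.IsStandard} => polytabloid T.1) := by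
  set t := Tableau.ofArm hn 0
  choose u hu using exists_polytabloid_eq hn t
  have h1 : LinearIndependent ℚ
      (fun b : {b : Fin (n + 1) // b ≠ 0} => spechtMap hn t (Pi.single b.1 1)) := by
    -- A relation makes ∑ c_b ε_b (over b ≠ 0) a constant vector; its coordinate at 0 vanishes, so
    -- all c_b do.
    rw [Fintype.linearIndependent_iff]
    intro c hc b
    rw [← Finset.sum_congr rfl fun b _ => map_smul (spechtMap hn t) (c b) _, ← map_sum,
      spechtMap_eq_zero_iff] at hc
    have h := hc b.1 0
    simpa [Finset.sum_apply, Pi.single_apply, Subtype.ext_iff.symm, b.2, Subtype.coe_inj,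
      fun d : {b : Fin (n + 1) // b ≠ 0} => d.2.symm] using h
  have h2 := h1.comp
    (fun T : {T : Tableau (hook n) (n + 1) // T.IsStandard} =>
      (⟨T.1.arm hn, Tableau.arm_ne_zero hn T.2⟩ : {b : Fin (n + 1) // b ≠ 0})) (by
      rintro ⟨T, hT⟩ ⟨T', hT'⟩ h
      have h' : T.arm hn = T'.arm hn := congrArg Subtype.val h
      exact Subtype.ext (by
        change T = T'
        rw [Tableau.eq_ofArm hn hT, Tableau.eq_ofArm hn hT', h']))
  have h3 := h2.units_smul fun T => Units.map (Int.castRingHom ℚ).toMonoidHom (u T.1)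
  convert h3 using 1
  ext1 T
  rw [hu T.1]
  simp [Units.smul_def, Int.cast_smul_eq_zsmul]

/-- The restriction of `spechtMap` to `ℤ^(n+1)`. -/
noncomputable def spechtMapInt (t : Tableau (hook n) (n + 1)) :
    (Fin (n + 1) → ℤ) →ₗ[ℤ] (Tabloid (hook n) (n + 1) →₀ ℚ) :=
  (spechtMap hn t).restrictScalars ℤ ∘ₗ castLin (n + 1)

theorem spechtMapInt_single (t : Tableau (hook n) (n + 1)) (b : Fin (n + 1)) :
    spechtMapInt hn t (Pi.single b 1) = spechtMap hn t (Pi.single b 1) := by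
  have : castLin (n + 1) (Pi.single b 1) = Pi.single b 1 := by
    ext a; simp [Pi.single_apply]
  rw [← this]; rfl

theorem mem_ker_spechtMapInt (t : Tableau (hook n) (n + 1)) {x : Fin (n + 1) → ℤ} :
    x ∈ LinearMap.ker (spechtMapInt hn t) ↔ ∀ a b, x a = x b := by
  refine (spechtMap_eq_zero_iff hn t).trans ?_
  simp

theorem spechtMapInt_signPermInt (t : Tableau (hook n) (n + 1)) (g : Equiv.Perm (Fin (n + 1)))
    (x : Fin (n + 1) → ℤ) :
    spechtMapInt hn t (signPermInt n g x) =
      permModule (hook n) (n + 1) g (spechtMapInt hn t x) := by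
  change spechtMap hn t (castLin (n + 1) _) = _
  rw [castLin_signPermInt, spechtMap_signPerm]
  rfl

theorem range_spechtMapInt (t : Tableau (hook n) (n + 1)) :
    LinearMap.range (spechtMapInt hn t) = spechtLattice (hook n) (n + 1) := by
  choose u hu using exists_polytabloid_eq hn t
  apply le_antisymm
  · have hne : ∀ b ≠ 0, spechtMapInt hn t (Pi.single b 1) ∈ spechtLattice (hook n) (n + 1) := by
      intro b hb
      have h := hu (Tableau.ofArm hn b)
      rw [show (Tableau.ofArm hn b).arm hn = b from Tableau.ofArm_armCell hn b] at h
      have h1 : spechtMapInt hn t (Pi.single b 1) =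
          (u (Tableau.ofArm hn b) : ℤ) • polytabloid (Tableau.ofArm hn b) := by
        rw [h, smul_smul, ← Units.val_mul, Int.units_mul_self, Units.val_one, one_smul,
          spechtMapInt_single]
      rw [h1]
      exact Submodule.smul_mem _ _ (Submodule.subset_span ⟨_, Tableau.isStandard_ofArm hn hb, rfl⟩)
    rintro _ ⟨x, rfl⟩
    -- Subtracting the constant vector x_0 does not change the image and removes ε_0, which belongs
    -- to no standard tableau.
    have hx : spechtMapInt hn t x = ∑ b, (x b - x 0) • spechtMapInt hn t (Pi.single b 1) := by
      rw [← Finset.sum_congr rfl fun b _ => map_smul (spechtMapInt hn t) (x b - x 0) _, ← map_sum,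
        ← sub_eq_zero, ← map_sub]
      refine (mem_ker_spechtMapInt hn t).2 fun a b => ?_
      simp [Finset.sum_apply, Pi.single_apply]
    rw [hx]
    refine Submodule.sum_mem _ fun b _ => ?_
    by_cases hb : b = 0
    · simp [hb]
    · exact Submodule.smul_mem _ _ (hne b hb)
  · rw [spechtLattice, Submodule.span_le]
    rintro _ ⟨T, -, rfl⟩
    rw [hu T, ← spechtMapInt_single]
    exact Submodule.smul_mem _ _ ⟨_, rfl⟩

end SpechtCraig

/-! ### Comparison of the two quotients -/

open SpechtCraig
theorem mainTheorem3 (n : ℕ) (hn : 2 ≤ n) :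
    LinearIndependent ℚ
      (fun T : {T : Tableau (hook n) (n + 1) // T.IsStandard} => polytabloid T.1) ∧
    ∃ S : Subrepresentation (restrictInt (permModule (hook n) (n + 1))),
      S.toSubmodule = spechtLattice (hook n) (n + 1) ∧
      Nonempty (S.toRepresentation.asModule ≃ₗ[MonoidAlgebra ℤ (Equiv.Perm (Fin (n + 1)))]
        (craigLattice n (n + 1) dvd_rfl).toRepresentation.asModule) ∧
      ∀ (p : ℕ) [Fact p.Prime], p ∣ n + 1 →
        (∃ N : Subrepresentation S.toRepresentation,
          (∀ N' : Subrepresentation S.toRepresentation, IsPMaximal p N' ↔ N' = N) ∧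
          N.toSubmodule.toAddSubgroup.index = p) ∧
        Nonempty ((completion p S.toRepresentation).asModule
          ≃ₗ[MonoidAlgebra ℤ_[p] (Equiv.Perm (Fin (n + 1)))]
          (completion p (craigLattice n (p ^ padicValNat p (n + 1))
            pow_padicValNat_dvd).toRepresentation).asModule) := by
  have hn1 : 1 ≤ n := by omega
  let t := Tableau.ofArm hn1 0
  -- Defining S as the range of an equivariant map makes stability immediate; it is identified with
  -- the span of the standard polytabloids at the end.
  let S : Subrepresentation (restrictInt (permModule (hook n) (n + 1))) :=
    ⟨LinearMap.range (spechtMapInt hn1 t), by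
      rintro g _ ⟨x, rfl⟩
      exact ⟨_, spechtMapInt_signPermInt hn1 t g x⟩⟩
  let f : (Fin (n + 1) → ℤ) →ₗ[ℤ] S.toSubmodule := (spechtMapInt hn1 t).rangeRestrict
  have hf : Function.Surjective f := LinearMap.surjective_rangeRestrict _
  have hfg : ∀ g x, S.toRepresentation g (f x) = f (signPermInt n g x) := fun g x =>
    Subtype.ext (spechtMapInt_signPermInt hn1 t g x).symm
  have hker : ∀ x, x ∈ LinearMap.ker f ↔ ∀ a b, x a = x b := fun x => by
    rw [← mem_ker_spechtMapInt hn1 t, LinearMap.ker_rangeRestrict]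
  let j : (craigLattice n (n + 1) dvd_rfl).toSubmodule →ₗ[ℤ] (Fin (n + 1) → ℚ) :=
    (emb n).restrictScalars ℤ ∘ₗ (craigSpan n (n + 1)).subtype
  have hj : Function.Injective j := (emb_injective n).comp Subtype.val_injective
  obtain ⟨e, he⟩ := exists_equiv_of_ker_eq f hf (centering n) j hj
    (by ext x; rw [hker, mem_ker_centering])
    (by
      rw [← map_craigSpan_eq_range_centering n hn]
      ext y
      exact ⟨fun ⟨x, hx, h⟩ => ⟨⟨x, hx⟩, h⟩, fun ⟨x, h⟩ => ⟨x.1, x.2, h⟩⟩)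
  have heg : ∀ g x, e (S.toRepresentation g x) =
      (craigLattice n (n + 1) dvd_rfl).toRepresentation g (e x) := by
    intro g y
    obtain ⟨x, rfl⟩ := hf y
    apply hj
    rw [hfg, he, centering_signPermInt, ← he]
    exact (emb_craigRep n g _).symm
  refine ⟨linearIndependent_polytabloid hn1, S, range_spechtMapInt hn1 t,
    nonempty_asModule_equiv e heg, fun p hp hpn => ⟨?_, ?_⟩⟩
  · exact exists_unique_isPMaximal hpn f hf hfg fun x hx => (hker x).1 hx
  · obtain ⟨m, hm⟩ := pow_padicValNat_dvd (p := p) (n := n + 1)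
    -- The cofactor m is prime to p because the full power of p in n+1 has been split off.
    refine nonempty_completion_craigLattice hm.symm (fun h => ?_) _ e heg
    refine pow_succ_padicValNat_not_dvd (p := p) (Nat.succ_ne_zero n) ?_
    rw [pow_succ]
    exact (mul_dvd_mul_left _ h).trans hm.symm.dvd
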